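/- Let $I$ be a positive integer. For a real array $\underline{\mathbf Y}\in\mathbb R^{I\times I\times 2}$ with frontal slices $\mathbf Y_1,\mathbf Y_2\in\mathbb R^{I\times I}$, let $\operatorname{rank}_\circ(\underline{\mathbf Y})$ be the least $R\ge 0$ such that $\underline{\mathbf Y}=\sum_{r=1}^R \mathbf x_r\circ\mathbf y_r\circ\mathbf z_r$ for some $\mathbf x_r,\mathbf y_r\in\mathbb R^I$, $\mathbf z_r\in\mathbb R^2$, where $\circ$ denotes the outer product. Let $$\mathcal S_I(I,I,2)=\{\underline{\mathbf Y}\in\mathbb R^{I\times I\times 2} \mid \operatorname{rank}_\circ(\underline{\mathbf Y})\le I\},$$ and let $\overline{\mathcal S}_I(I,I,2)$ be its closure in $\mathbb R^{I\times I\times 2}$ (with respect to the Frobenius norm). Let $\mathcal P_I(I,I,2)$ be the set of arrays with a full generalized Schur decomposition, that is, the set of all $\underline{\mathbf Y}\in\mathbb R^{I\times I\times 2}$ for which there exist real $I\times I$ matrices $\mathbf Q_a,\mathbf Q_b$ with $\mathbf Q_a^T\mathbf Q_a=\mathbf Q_b^T\mathbf Q_b=\mathbf I_I$ and upper triangular (possibly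 singular) real $I\times I$ matrices $\mathbf R_1,\mathbf R_2$ such that $\mathbf Y_k=\mathbf Q_a\mathbf R_k\mathbf Q_b^T$ for $k=1,2$. Then $$\mathcal P_I(I,I,2)=\overline{\mathcal S}_I(I,I,2).$$ -/

import Mathlib

/-- Real `I × J × K` arrays, with the product topology. On this finite-dimensional space it is
the topology of the Frobenius norm. -/
abbrev Array3 (I J K : ℕ) : Type := Fin I → Fin J → Fin K → ℝ

/-- The outer product `x ∘ y ∘ z` of three vectors. -/
def outerProduct {I J K : ℕ} (x : Fin I → ℝ) (y : Fin J → ℝ) (z : Fin K → ℝ) : Array3 I J K :=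
  fun i j k => x i * y j * z k

/-- `Y` is a sum of `R` outer products. -/
def IsSumOfOuterProducts {I J K : ℕ} (Y : Array3 I J K) (R : ℕ) : Prop :=
  ∃ (x : Fin R → Fin I → ℝ) (y : Fin R → Fin J → ℝ) (z : Fin R → Fin K → ℝ),
    Y = ∑ r, outerProduct (x r) (y r) (z r)

/-- Every array is a finite sum of outer products, so the minimum defining the rank exists. -/
theorem exists_isSumOfOuterProducts {I J K : ℕ} (Y : Array3 I J K) :
    ∃ R : ℕ, IsSumOfOuterProducts Y R := by
  let e := (Fintype.equivFin (Fin I × Fin J × Fin K)).symm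
  refine ⟨Fintype.card (Fin I × Fin J × Fin K), fun r => Pi.single (e r).1 1,
    fun r => Pi.single (e r).2.1 1, fun r => Pi.single (e r).2.2 (Y (e r).1 (e r).2.1 (e r).2.2), ?_⟩
  rw [Equiv.sum_comp e (fun p => outerProduct (Pi.single p.1 (1 : ℝ)) (Pi.single p.2.1 (1 : ℝ))
    (Pi.single p.2.2 (Y p.1 p.2.1 p.2.2)))]
  funext i j k
  simp [Fintype.sum_prod_type, Finset.sum_apply, outerProduct, Pi.single_apply]

open Classical in
/-- The outer-product rank: the least `R` such that `Y` is a sum of `R` outer products. -/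
noncomputable def outerRank {I J K : ℕ} (Y : Array3 I J K) : ℕ :=
  Nat.find (exists_isSumOfOuterProducts Y)

/-- The set `S_R(I, J, K)` of arrays of outer-product rank at most `R`. -/
def rankSet (R I J K : ℕ) : Set (Array3 I J K) :=
  {Y | outerRank Y ≤ R}

/-- The `k`-th frontal slice of `Y`. -/
def frontalSlice {I J K : ℕ} (Y : Array3 I J K) (k : Fin K) : Matrix (Fin I) (Fin J) ℝ :=
  Matrix.of fun i j => Y i j k

/-- The set `P_R(I, J, 2)` of `I × J × 2` arrays with a full `R`-term generalized Schur
decomposition: both slices have the form `Y_k = Q_a R_k Q_bᵀ`, with common column-wise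
orthonormal `Q_a`, `Q_b` and upper triangular `R_k`. -/
def gsdSet (R I J : ℕ) : Set (Array3 I J 2) :=
  {Y | ∃ (Qa : Matrix (Fin I) (Fin R) ℝ) (Qb : Matrix (Fin J) (Fin R) ℝ)
      (T : Fin 2 → Matrix (Fin R) (Fin R) ℝ),
      Qa.transpose * Qa = 1 ∧ Qb.transpose * Qb = 1 ∧
      ∀ k, (T k).IsUpperTriangular ∧
        frontalSlice Y k = Qa * T k * Qb.transpose}

/-!
The inclusion of the closure in `gsdSet I I I` has two ingredients. If `Y` has rank at most `I`,
its slices are `A * diagonal d * Bᵀ` with common square factors `A`, `B`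
(`isSumOfOuterProducts_iff`). Gram–Schmidt makes `Qaᵀ * A` and `Bᵀ * Qb` upper triangular for
suitable orthogonal `Qa`, `Qb`, so `Y` has a full generalized Schur decomposition
(`mem_gsdSet_of_isSumOfOuterProducts`). Moreover `gsdSet I I I` is closed (`isClosed_gsdSet`):
it is the set of arrays for which some point of the compact set of pairs of orthogonal matrices
makes all `Qaᵀ * Y_k * Qb` upper triangular, and that is a closed condition.

Conversely, if `S` and `T` are upper triangular, `S` has nonzero diagonal and the ratios
`T i i / S i i` are pairwise distinct, then these ratios are the eigenvalues of `T * S⁻¹`, which is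
therefore diagonalizable, and `S`, `T` factor as `V * diagonal d * W` with common `V`, `W`
(`exists_common_factorization`). An array with such triangular factors has rank at most `I`.
Adding `t` times the identity to the first triangular factor and `t * diag(0, 1, …, I - 1)` to the
second produces this situation for all small `t ≠ 0`, because the conditions fail only at roots of
finitely many nonzero polynomials in `t`.
-/

open Matrix Filter Topology

/-! ### Rank and factorizations of the slices -/

theorem IsSumOfOuterProducts.mono {I J K R R' : ℕ} {Y : Array3 I J K}
    (h : IsSumOfOuterProducts Y R) (hR : R ≤ R') : IsSumOfOuterProducts Y R' := by
  induction R', hR using Nat.le_induction with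
  | base => exact h
  | succ n _ ih =>
    obtain ⟨x, y, z, rfl⟩ := ih
    refine ⟨Fin.snoc x 0, Fin.snoc y 0, Fin.snoc z 0, ?_⟩
    have h0 : outerProduct (0 : Fin I → ℝ) (0 : Fin J → ℝ) (0 : Fin K → ℝ) = 0 := by
      funext i j k
      simp [outerProduct]
    simp [Fin.sum_univ_castSucc, h0]

theorem mem_rankSet_iff {I J K R : ℕ} {Y : Array3 I J K} :
    Y ∈ rankSet R I J K ↔ IsSumOfOuterProducts Y R := by
  classical
  constructor
  · intro h
    exact (Nat.find_spec (exists_isSumOfOuterProducts Y)).mono h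
  · intro h
    exact Nat.find_min' (exists_isSumOfOuterProducts Y) h

/-- A sum of `R` outer products is the same as a simultaneous factorization of the slices through
diagonal matrices of size `R`. -/
theorem isSumOfOuterProducts_iff {I J K R : ℕ} {Y : Array3 I J K} :
    IsSumOfOuterProducts Y R ↔
      ∃ (A : Matrix (Fin I) (Fin R) ℝ) (B : Matrix (Fin J) (Fin R) ℝ) (d : Fin K → Fin R → ℝ),
        ∀ k, frontalSlice Y k = A * diagonal (d k) * Bᵀ := by
  constructor
  · rintro ⟨x, y, z, rfl⟩
    refine ⟨of fun i r => x r i, of fun j r => y r j, fun k r => z r k, fun k => ?_⟩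
    ext i j
    simp only [frontalSlice, of_apply, Finset.sum_apply, outerProduct, mul_apply (N := _ᵀ),
      mul_diagonal, transpose_apply]
    exact Finset.sum_congr rfl fun r _ => by ring
  · rintro ⟨A, B, d, h⟩
    refine ⟨fun r i => A i r, fun r j => B j r, fun r k => d k r, ?_⟩
    funext i j k
    have := congrFun (congrFun (h k) i) j
    simp only [frontalSlice, of_apply, mul_apply (N := _ᵀ), mul_diagonal, transpose_apply] at this
    rw [this]
    simp only [Finset.sum_apply, outerProduct]
    exact Finset.sum_congr rfl fun r _ => by ring

/-! ### Orthogonal triangularization -/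

theorem exists_orthogonal_isUpperTriangular {n : ℕ} (A : Matrix (Fin n) (Fin n) ℝ) :
    ∃ Q : Matrix (Fin n) (Fin n) ℝ, Qᵀ * Q = 1 ∧ (Qᵀ * A).IsUpperTriangular := by
  let f : Fin n → EuclideanSpace ℝ (Fin n) := fun j => WithLp.toLp 2 fun i => A i j
  have hn : Module.finrank ℝ (EuclideanSpace ℝ (Fin n)) = Fintype.card (Fin n) := by simp
  let b := InnerProductSpace.gramSchmidtOrthonormalBasis hn f
  have hb : ∀ (i : Fin n) (v : EuclideanSpace ℝ (Fin n)), inner ℝ (b i) v = ∑ l, b i l * v l := by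
    intro i v
    simp [PiLp.inner_apply, mul_comm]
  refine ⟨of fun i j => b j i, ?_, ?_⟩
  · ext i j
    have := orthonormal_iff_ite.mp b.orthonormal i j
    rw [hb] at this
    simpa [mul_apply, one_apply] using this
  · intro i j hij
    have := InnerProductSpace.gramSchmidtOrthonormalBasis_inv_triangular hn f hij
    change inner ℝ (b i) (f j) = 0 at this
    rw [hb] at this
    simpa [mul_apply, f] using this

theorem exists_orthogonal_transpose_mul_isUpperTriangular {n : ℕ} (B : Matrix (Fin n) (Fin n) ℝ) :
    ∃ Q : Matrix (Fin n) (Fin n) ℝ, Qᵀ * Q = 1 ∧ (Bᵀ * Q).IsUpperTriangular := by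
  -- Reversing the order of the columns of `B` and of `Q` turns upper into lower triangular.
  obtain ⟨Q, hQ, hT⟩ := exists_orthogonal_isUpperTriangular (B.submatrix id Fin.rev)
  refine ⟨Q.submatrix id Fin.rev, ?_, ?_⟩
  · ext i j
    have := congrFun (congrFun hQ i.rev) j.rev
    simpa [mul_apply, one_apply] using this
  · intro i j hij
    have := @hT j.rev i.rev (Fin.rev_lt_rev.mpr hij)
    simpa [mul_apply, mul_comm] using this

theorem mem_gsdSet_iff {I : ℕ} {Y : Array3 I I 2} :
    Y ∈ gsdSet I I I ↔ ∃ Qa Qb : Matrix (Fin I) (Fin I) ℝ, Qaᵀ * Qa = 1 ∧ Qbᵀ * Qb = 1 ∧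
      ∀ k, (Qaᵀ * frontalSlice Y k * Qb).IsUpperTriangular := by
  constructor
  · rintro ⟨Qa, Qb, T, ha, hb, h⟩
    refine ⟨Qa, Qb, ha, hb, fun k => ?_⟩
    rw [(h k).2, show Qaᵀ * (Qa * T k * Qbᵀ) * Qb = (Qaᵀ * Qa) * T k * (Qbᵀ * Qb) by
      simp only [Matrix.mul_assoc], ha, hb, Matrix.one_mul, Matrix.mul_one]
    exact (h k).1
  · rintro ⟨Qa, Qb, ha, hb, h⟩
    refine ⟨Qa, Qb, fun k => Qaᵀ * frontalSlice Y k * Qb, ha, hb, fun k => ⟨h k, ?_⟩⟩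
    rw [show Qa * (Qaᵀ * frontalSlice Y k * Qb) * Qbᵀ = (Qa * Qaᵀ) * frontalSlice Y k * (Qb * Qbᵀ) by
      simp only [Matrix.mul_assoc], mul_eq_one_comm.mp ha, mul_eq_one_comm.mp hb,
      Matrix.one_mul, Matrix.mul_one]

theorem mem_gsdSet_of_isSumOfOuterProducts {I : ℕ} {Y : Array3 I I 2}
    (h : IsSumOfOuterProducts Y I) : Y ∈ gsdSet I I I := by
  obtain ⟨A, B, d, h⟩ := isSumOfOuterProducts_iff.mp h
  obtain ⟨Qa, ha, hA⟩ := exists_orthogonal_isUpperTriangular A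
  obtain ⟨Qb, hb, hB⟩ := exists_orthogonal_transpose_mul_isUpperTriangular B
  refine mem_gsdSet_iff.mpr ⟨Qa, Qb, ha, hb, fun k => ?_⟩
  rw [h k, show Qaᵀ * (A * diagonal (d k) * Bᵀ) * Qb = (Qaᵀ * A) * diagonal (d k) * (Bᵀ * Qb) by
    simp only [Matrix.mul_assoc]]
  exact (hA.mul (blockTriangular_diagonal _)).mul hB

/-! ### Closedness of the set of generalized Schur decompositions -/

theorem isCompact_setOf_transpose_mul_self_eq_one (n : ℕ) :
    IsCompact {Q : Matrix (Fin n) (Fin n) ℝ | Qᵀ * Q = 1} := by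
  have hK : IsCompact (Set.univ.pi fun _ : Fin n => Set.univ.pi fun _ : Fin n =>
      Set.Icc (-1 : ℝ) 1) :=
    isCompact_univ_pi fun _ => isCompact_univ_pi fun _ => isCompact_Icc
  refine hK.of_isClosed_subset (isClosed_eq (by fun_prop) continuous_const) ?_
  intro (Q : Matrix (Fin n) (Fin n) ℝ) (hQ : Qᵀ * Q = 1) i _ j _
  have hQ' : Q ∈ unitaryGroup (Fin n) ℝ :=
    mem_unitaryGroup_iff'.mpr (by simpa [star_eq_conjTranspose] using hQ)
  exact abs_le.mp (entry_norm_bound_of_unitary hQ' i j)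

theorem isClosed_gsdSet (I : ℕ) : IsClosed (gsdSet I I I) := by
  let K := {Q : Matrix (Fin I) (Fin I) ℝ | Qᵀ * Q = 1}
  have : CompactSpace K :=
    isCompact_iff_compactSpace.mp (isCompact_setOf_transpose_mul_self_eq_one I)
  let F : Set ((K × K) × Array3 I I 2) := {p | ∀ k : Fin 2, ∀ i j : Fin I, j < i →
    ((p.1.1 : Matrix (Fin I) (Fin I) ℝ)ᵀ * frontalSlice p.2 k * (p.1.2 : Matrix (Fin I) (Fin I) ℝ)) i j = 0}
  have hF : IsClosed F := by
    have hs : ∀ k : Fin 2, Continuous fun p : (K × K) × Array3 I I 2 => frontalSlice p.2 k := by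
      intro k
      refine continuous_matrix fun i j => ?_
      simp only [frontalSlice, of_apply]
      fun_prop
    simp only [F, Set.ofPred_forall]
    refine isClosed_iInter fun k => isClosed_iInter fun i => isClosed_iInter fun j =>
      isClosed_iInter fun _ => isClosed_eq ?_ continuous_const
    have := hs k
    exact Continuous.matrix_elem (A := fun p : (K × K) × Array3 I I 2 =>
      (p.1.1 : Matrix (Fin I) (Fin I) ℝ)ᵀ * frontalSlice p.2 k * (p.1.2 : Matrix (Fin I) (Fin I) ℝ))
      (by fun_prop) i j
  convert isClosedMap_snd_of_compactSpace F hF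
  ext Y
  rw [mem_gsdSet_iff]
  constructor
  · rintro ⟨Qa, Qb, ha, hb, h⟩
    exact ⟨((⟨Qa, ha⟩, ⟨Qb, hb⟩), Y), fun k i j hij => h k hij, rfl⟩
  · rintro ⟨⟨⟨Qa, Qb⟩, _⟩, h, rfl⟩
    exact ⟨Qa, Qb, Qa.2, Qb.2, fun k i j hij => h k i j hij⟩

/-! ### Simultaneous factorization of a generic pair of triangular matrices -/

/-- An upper triangular pencil whose generalized eigenvalues `T i i / S i i` are finite and
pairwise distinct is simultaneously diagonalized by equivalence. -/
theorem exists_common_factorization {n : Type*} [Fintype n] [LinearOrder n]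
    {S T : Matrix n n ℝ} (hS : S.IsUpperTriangular) (hT : T.IsUpperTriangular)
    (hS0 : ∀ i, S i i ≠ 0) (hST : ∀ i j, i ≠ j → T i i * S j j ≠ T j j * S i i) :
    ∃ (V W : Matrix n n ℝ) (d : n → ℝ), S = V * W ∧ T = V * diagonal d * W := by
  have hdet : IsUnit S.det := by
    rw [det_of_isUpperTriangular hS, isUnit_iff_ne_zero]
    exact Finset.prod_ne_zero_iff.mpr fun i _ => hS0 i
  let d : n → ℝ := fun i => T i i / S i i
  have hd : Function.Injective d := by
    intro i j hij
    by_contra hne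
    exact hST i j hne ((div_eq_div_iff (hS0 i) (hS0 j)).mp hij)
  have hev : ∀ i, ∃ v : n → ℝ, v ≠ 0 ∧ (T * S⁻¹) *ᵥ v = d i • v := by
    intro i
    have hz : (T - d i • S).det = 0 := by
      rw [det_of_isUpperTriangular (hT.sub fun a b hab => by simp [hS hab])]
      refine Finset.prod_eq_zero (Finset.mem_univ i) ?_
      simp [d, hS0 i]
    have hz' : (T * S⁻¹ - d i • (1 : Matrix n n ℝ)).det = 0 := by
      have : T * S⁻¹ - d i • (1 : Matrix n n ℝ) = (T - d i • S) * S⁻¹ := by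
        rw [Matrix.sub_mul, smul_mul, mul_nonsing_inv S hdet]
      rw [this, det_mul, hz, zero_mul]
    obtain ⟨v, hv, h⟩ := exists_mulVec_eq_zero_iff.mpr hz'
    refine ⟨v, hv, ?_⟩
    rwa [sub_mulVec, smul_mulVec, one_mulVec, sub_eq_zero] at h
  choose v hv0 hv using hev
  have hli : LinearIndependent ℝ v :=
    Module.End.eigenvectors_linearIndependent' (toLin' (T * S⁻¹)) d hd v fun i =>
      Module.End.hasEigenvector_iff.mpr
        ⟨Module.End.mem_eigenspace_iff.mpr (by simpa using hv i), hv0 i⟩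
  let V : Matrix n n ℝ := (of v)ᵀ
  have hV : IsUnit V.det := by
    rw [← isUnit_iff_isUnit_det, ← linearIndependent_cols_iff_isUnit]
    exact hli
  have hTV : T * S⁻¹ * V = V * diagonal d := by
    ext i j
    have := congrFun (hv j) i
    rw [mul_diagonal]
    simpa [mulVec, dotProduct, mul_apply (N := V), V, mul_comm] using this
  refine ⟨V, V⁻¹ * S, d, ?_, ?_⟩
  · rw [← Matrix.mul_assoc, mul_nonsing_inv V hV, Matrix.one_mul]
  · rw [← hTV, Matrix.mul_assoc, ← Matrix.mul_assoc V, mul_nonsing_inv V hV, Matrix.one_mul,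
      Matrix.mul_assoc, nonsing_inv_mul S hdet, Matrix.mul_one]

/-! ### Perturbation to a generic pair -/

theorem Polynomial.eventually_eval_ne_zero {p : Polynomial ℝ} (hp : p ≠ 0) (a : ℝ) :
    ∀ᶠ t in 𝓝[≠] a, p.eval t ≠ 0 := by
  have hfin : ({t | p.IsRoot t} \ {a}).Finite := (Polynomial.finite_setOfPred_isRoot hp).sdiff
  filter_upwards [mem_nhdsWithin_of_mem_nhds (hfin.isClosed.isOpen_compl.mem_nhds (x := a)
    (by simp)), self_mem_nhdsWithin] with t ht hta h0
  exact ht ⟨h0, hta⟩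

/-- The difference of the two sides is a polynomial in `t` with leading coefficient `c - c'`. -/
theorem eventually_add_mul_add_ne (a a' b b' : ℝ) {c c' : ℝ} (hc : c ≠ c') :
    ∀ᶠ t in 𝓝[≠] (0 : ℝ), (b + t * c) * (a' + t) ≠ (b' + t * c') * (a + t) := by
  let p : Polynomial ℝ := .C (c - c') * .X ^ 2 + .C (b + c * a' - b' - c' * a) * .X +
    .C (b * a' - b' * a)
  have hp : p ≠ 0 := by
    intro h
    have := Polynomial.leadingCoeff_quadratic (b := b + c * a' - b' - c' * a)
      (c := b * a' - b' * a) (sub_ne_zero.mpr hc)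
    change p.leadingCoeff = _ at this
    rw [h, Polynomial.leadingCoeff_zero] at this
    exact sub_ne_zero.mpr hc this.symm
  filter_upwards [Polynomial.eventually_eval_ne_zero hp 0] with t ht h
  apply ht
  simp only [p, Polynomial.eval_add, Polynomial.eval_mul, Polynomial.eval_C, Polynomial.eval_X,
    Polynomial.eval_pow]
  linear_combination h

theorem gsdSet_subset_closure_rankSet (I : ℕ) : gsdSet I I I ⊆ closure (rankSet I I I 2) := by
  rintro Y ⟨Qa, Qb, T, ha, hb, h⟩
  -- The first row of `c` perturbs the diagonal of `T 0`, the second that of `T 1`.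
  let c : Fin 2 → Fin I → ℝ := ![fun _ => 1, fun i => (i : ℕ)]
  let T' : ℝ → Fin 2 → Matrix (Fin I) (Fin I) ℝ := fun t k => T k + t • diagonal (c k)
  let Z : ℝ → Array3 I I 2 := fun t i j k => (Qa * T' t k * Qbᵀ) i j
  have hZ0 : Z 0 = Y := by
    funext i j k
    simp only [Z, T', zero_smul, add_zero, ← (h k).2, frontalSlice, of_apply]
  have hZ : Tendsto Z (𝓝[≠] 0) (𝓝 Y) := by
    have hc : Continuous Z := by
      refine continuous_pi fun i => continuous_pi fun j => continuous_pi fun k => ?_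
      exact Continuous.matrix_elem (A := fun t => Qa * T' t k * Qbᵀ) (by fun_prop) i j
    exact hZ0 ▸ (hc.tendsto 0).mono_left nhdsWithin_le_nhds
  refine mem_closure_of_tendsto hZ ?_
  have h1 : ∀ᶠ t in 𝓝[≠] (0 : ℝ), ∀ i, T' t 0 i i ≠ 0 := by
    refine eventually_all.mpr fun i => ?_
    filter_upwards [Polynomial.eventually_eval_ne_zero (Polynomial.X_add_C_ne_zero (T 0 i i)) 0]
      with t ht
    simpa [T', c, add_comm] using ht
  have h2 : ∀ᶠ t in 𝓝[≠] (0 : ℝ), ∀ i j, i ≠ j →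
      T' t 1 i i * T' t 0 j j ≠ T' t 1 j j * T' t 0 i i := by
    refine eventually_all.mpr fun i => eventually_all.mpr fun j => eventually_imp_distrib_left.mpr
      fun hij => ?_
    have hne : ((i : ℕ) : ℝ) ≠ ((j : ℕ) : ℝ) := by
      exact_mod_cast Fin.val_ne_of_ne hij
    filter_upwards [eventually_add_mul_add_ne (T 0 i i) (T 0 j j) (T 1 i i) (T 1 j j) hne] with t ht
    simpa [T', c] using ht
  filter_upwards [h1, h2] with t ht1 ht2
  have hup : ∀ k, (T' t k).IsUpperTriangular := fun k =>
    (h k).1.add fun i j hij => by simp [blockTriangular_diagonal (c k) hij]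
  obtain ⟨V, W, d, hS, hT⟩ := exists_common_factorization (hup 0) (hup 1) ht1 ht2
  rw [mem_rankSet_iff, isSumOfOuterProducts_iff]
  refine ⟨Qa * V, Qb * Wᵀ, ![fun _ => 1, d], fun k => ?_⟩
  have hsl : frontalSlice (Z t) k = Qa * T' t k * Qbᵀ := rfl
  have hk : T' t k = V * diagonal ((![fun _ => 1, d] : Fin 2 → Fin I → ℝ) k) * W := by
    fin_cases k
    · simpa using hS
    · simpa using hT
  rw [hsl, hk, transpose_mul, transpose_transpose]
  simp only [Matrix.mul_assoc]

theorem theorem1 (I : ℕ) : gsdSet I I I = closure (rankSet I I I 2) :=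
  (gsdSet_subset_closure_rankSet I).antisymm <|
    closure_minimal (fun _ hY => mem_gsdSet_of_isSumOfOuterProducts (mem_rankSet_iff.mp hY))
      (isClosed_gsdSet I)
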